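/- A \emph{loopless mixed graph} on a finite node set $V$ has edges of three types, lines $i - j$, arrows $i\to j$ and arcs $i\leftrightarrow j$, each between two distinct nodes. The edges $i\to j$ and $i\leftrightarrow j$ have an arrowhead at $j$ (and $i\leftrightarrow j$ also one at $i$). The \emph{skeleton} is obtained by replacing every edge by a line. A \emph{regression chain graph} (RCG) is a loopless mixed graph in which no arrowhead points to an endpoint of a line and there is no cycle of arrows and arcs that contains at least one arrow and whose arrows all point in the same direction around the cycle (cycles of length two and cycles consisting of arrows only are included; in particular there is at most one edge between any two nodes). A \emph{V-configuration} $\langle i,t,j\rangle$ is a path with three distinct nodes and two edges; it is a \emph{collider} V-configuration, and $t$ a collider on it, if both edges have an arrowhead at $t$, and it is \emph{unshielded} if $i$ and $j$ are not adjacent. Given $C\subseteq V$, let $\mathrm{an}(C)$ be the set of nodes from which there is a directed path of arrows to a member of $C$. A path is $m$-connecting given $C$ if all its inner collider nodes are in $C\cup\mathrm{an}(C)$ and all its inner non-collider nodes are outside $C$. For pairwise disjoint $A,B,C\subseteq V$, $A\perp_m B\mid C$ means that there is no path between $A$ and $B$ that is $m$-connecting given $C$. Two graphs on $V$ are \emph{Markov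 equivalent} if the same statements $A\perp_m B\mid C$ hold in both. A path $\langle j,q_1,\dots,q_m,l,i\rangle$, $m\ge1$, with $j$ and $i$ not adjacent, is a \emph{discriminating path} for $\langle q_m,l,i\rangle$ if every $q_n$, $1\le n\le m$, is a collider on the path and $q_n\to i$. A triple $\langle h,l,i\rangle$ has order $0$ if $h$ and $i$ are not adjacent; it has order $n+1$ if it does not have order $\le n$ and there is a discriminating path $\langle j,q_1,\dots,q_m=h,l,i\rangle$ such that each of the triples $\langle j,q_1,q_2\rangle,\dots,\langle q_{m-1},q_m,l\rangle$ has order at most $n$. A \emph{collider with order} is a collider V-configuration that has order $n$ for some $n\ge 0$. \textbf{Proposition.} (1) Two regression chain graphs $H_1$ and $H_2$ on the same finite node set are Markov equivalent if and only if they have the same skeleton and the same unshielded collider V-configurations $\langle i,t,j\rangle$ (as triples of nodes). (2) In a regression chain graph every collider with order is unshielded. -/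

import Mathlib

/-- A loopless mixed graph on the node set `V`: `arrow i j` is `i → j`, `arc i j` is `i ↔ j`
and `line i j` is `i — j`. -/
structure MixedGraph (V : Type*) where
  arrow : V → V → Prop
  arc : V → V → Prop
  line : V → V → Prop
  arc_symm : ∀ {i j}, arc i j → arc j i
  line_symm : ∀ {i j}, line i j → line j i
  arrow_loopless : ∀ i, ¬ arrow i i
  arc_loopless : ∀ i, ¬ arc i i
  line_loopless : ∀ i, ¬ line i i

namespace MixedGraph

variable {V : Type*}

/-- The skeleton: every edge is replaced by an undirected one.  Two nodes are adjacent in the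
mixed graph exactly if they are adjacent in the skeleton. -/
def skeleton (H : MixedGraph V) : SimpleGraph V where
  Adj i j := H.arrow i j ∨ H.arrow j i ∨ H.arc i j ∨ H.line i j
  symm := ⟨by
    rintro i j (h | h | h | h)
    · exact Or.inr (Or.inl h)
    · exact Or.inl h
    · exact Or.inr (Or.inr (Or.inl (H.arc_symm h)))
    · exact Or.inr (Or.inr (Or.inr (H.line_symm h)))⟩
  loopless := ⟨by
    rintro i (h | h | h | h)
    · exact H.arrow_loopless i h
    · exact H.arrow_loopless i h
    · exact H.arc_loopless i h
    · exact H.line_loopless i h⟩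

/-- There is an edge between `i` and `j` with an arrowhead pointing at `j`. -/
def HeadAt (H : MixedGraph V) (i j : V) : Prop := H.arrow i j ∨ H.arc i j

/-- A regression chain graph: no arrowhead points to an endpoint of a line, and there is no cycle
of arrows and arcs that contains at least one arrow and whose arrows all point in one direction
(such a cycle through the arrow `i → j` returns from `j` to `i` along arrows, followed forwards,
and arcs; cycles of length two, i.e. double edges, and cycles without arcs are included). -/
structure IsRegressionChainGraph (H : MixedGraph V) : Prop where
  no_head_at_line : ∀ i j k, H.HeadAt i j → ¬ H.line j k
  no_arc_direction_preserving_cycle :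
    ∀ i j, H.arrow i j → ¬ Relation.ReflTransGen (fun a b => H.arrow a b ∨ H.arc a b) j i

/-- Between two nodes of a regression chain graph there is at most one edge.  Hence a path is
determined by its sequence of nodes, i.e. it is the same as a path in the skeleton. -/
theorem IsRegressionChainGraph.edge_unique {H : MixedGraph V} (hH : H.IsRegressionChainGraph)
    (i j : V) :
    ¬ (H.arrow i j ∧ H.arrow j i) ∧ ¬ (H.arrow i j ∧ H.arc i j) ∧
      ¬ (H.arrow i j ∧ H.line i j) ∧ ¬ (H.arc i j ∧ H.line i j) :=
  ⟨fun h => hH.2 i j h.1 (Relation.ReflTransGen.single (Or.inl h.2)),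
   fun h => hH.2 i j h.1 (Relation.ReflTransGen.single (Or.inr (H.arc_symm h.2))),
   fun h => hH.1 i j i (Or.inl h.1) (H.line_symm h.2),
   fun h => hH.1 i j i (Or.inr h.1) (H.line_symm h.2)⟩

/-- `⟨i, t, j⟩` is a collider V-configuration: a path with three nodes and two edges which both
have an arrowhead at the inner node `t`. -/
def IsCollider (H : MixedGraph V) (i t j : V) : Prop :=
  i ≠ j ∧ H.HeadAt i t ∧ H.HeadAt j t

/-- A collider V-configuration whose endpoints are not adjacent. -/
def IsUnshieldedCollider (H : MixedGraph V) (i t j : V) : Prop :=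
  H.IsCollider i t j ∧ ¬ H.skeleton.Adj i j

/-- `an(C)`: the nodes from which there is a direction-preserving path to a member of `C`. -/
def ancestors (H : MixedGraph V) (C : Set V) : Set V :=
  {a | ∃ c ∈ C, Relation.TransGen H.arrow a c}

/-- The path `p` is `m`-connecting given `C`: every inner node that is a collider on `p` is in
`C ∪ an(C)`, and every inner node that is a non-collider on `p` is outside `C`. -/
def IsMConnecting (H : MixedGraph V) (C : Set V) {a b : V} (p : H.skeleton.Walk a b) : Prop :=
  p.IsPath ∧ ∀ n, n + 2 ≤ p.length →
    (H.IsCollider (p.getVert n) (p.getVert (n + 1)) (p.getVert (n + 2)) →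
      p.getVert (n + 1) ∈ C ∪ H.ancestors C) ∧
    (¬ H.IsCollider (p.getVert n) (p.getVert (n + 1)) (p.getVert (n + 2)) →
      p.getVert (n + 1) ∉ C)

/-- `A` and `B` are `m`-separated by `C`. -/
def MSep (H : MixedGraph V) (A B C : Set V) : Prop :=
  ∀ a ∈ A, ∀ b ∈ B, ∀ p : H.skeleton.Walk a b, ¬ H.IsMConnecting C p

/-- Two graphs on the same node set are Markov equivalent if they have the same `m`-separations
among pairwise disjoint sets of nodes. -/
def MarkovEquivalent (H₁ H₂ : MixedGraph V) : Prop :=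
  ∀ A B C : Set V, Disjoint A B → Disjoint A C → Disjoint B C →
    (H₁.MSep A B C ↔ H₂.MSep A B C)

/-- The path `p = ⟨j, q₁, …, qₘ, l, i⟩` with `m ≥ 1` and `j` not adjacent to `i` is a
discriminating path for `⟨qₘ, l, i⟩`: every `qₙ` is a collider on `p` and satisfies `qₙ → i`. -/
def IsDiscriminatingPath (H : MixedGraph V) {j i : V} (p : H.skeleton.Walk j i) : Prop :=
  p.IsPath ∧ ¬ H.skeleton.Adj j i ∧ 3 ≤ p.length ∧
    ∀ n, n + 3 ≤ p.length →
      H.IsCollider (p.getVert n) (p.getVert (n + 1)) (p.getVert (n + 2)) ∧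
      H.arrow (p.getVert (n + 1)) i

/-- The triple `⟨h, l, i⟩` has order at most `n`.  It has order `0` if `h` and `i` are not
adjacent; it has order at most `n + 1` if it has order at most `n` or there is a discriminating
path `⟨j, q₁, …, qₘ = h, l, i⟩` whose colliders `⟨j, q₁, q₂⟩, …, ⟨qₘ₋₁, qₘ, l⟩` all have order
at most `n`. -/
def OrderAtMost (H : MixedGraph V) : ℕ → V → V → V → Prop
  | 0, h, _, i => ¬ H.skeleton.Adj h i
  | n + 1, h, l, i => H.OrderAtMost n h l i ∨
      ∃ (j : V) (p : H.skeleton.Walk j i), H.IsDiscriminatingPath p ∧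
        p.getVert (p.length - 2) = h ∧ p.getVert (p.length - 1) = l ∧
        ∀ k, k + 3 ≤ p.length →
          H.OrderAtMost n (p.getVert k) (p.getVert (k + 1)) (p.getVert (k + 2))

/-- A collider V-configuration that has order `n` for some `n`. -/
def IsColliderWithOrder (H : MixedGraph V) (h l i : V) : Prop :=
  H.IsCollider h l i ∧ ∃ n, H.OrderAtMost n h l i

end MixedGraph

namespace MixedGraph

open Relation

/-! ### Arrowheads, triangles, and colliders with order. -/

section Basic

variable {V : Type*} {H : MixedGraph V}

/-! Markov equivalence determines the graph data because regression chain graphs are maximal.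
Nonadjacent `a` and `b` are separated by their common anterior set without `a` and `b`
(`IsRegressionChainGraph.exists_mSep`), so adjacency can be read off the separations. For an
unshielded triple `⟨i, t, j⟩`, a set separating `i` from `j` contains `t` exactly if `t` is not a
collider.

For the converse, `m`-connection is compared with connection outside `C` in a moral graph on a set
`T`, where two nodes are joined if they are adjacent or linked by a walk of colliders in `T`. For
fixed `T` this relation depends only on the skeleton and the unshielded colliders, since a collision
walk between nonadjacent nodes can be shortened until all its triples are unshielded
(`SameUnshielded.moralAdj`).

What depends on the graph is the choice of `T`, as ancestors differ between equivalent graphs.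
Anterior sets are therefore replaced by the weaker condition `HasExits`. A connecting path in `H₁`
gives a moral walk on a set with exits in `H₁`. Nodes that lack an exit in `H₂` are deleted one at a
time, preserving both the exits in `H₁` and the moral walk (`SameUnshielded.exists_hasExits`). On
the remaining set exits exist in `H₂`, and the moral walk yields a connecting path there
(`MoralReachable.not_mSep`).

The second claim holds because a discriminating path ending in a collider would close a forbidden
cycle. -/

theorem HeadAt.adj {i j : V} (h : H.HeadAt i j) : H.skeleton.Adj i j := by
  rcases h with h | h
  · exact Or.inl h
  · exact Or.inr (Or.inr (Or.inl h))

theorem HeadAt.ne {i j : V} (h : H.HeadAt i j) : i ≠ j := h.adj.ne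

theorem adj_cases {i j : V} (h : H.skeleton.Adj i j) :
    H.HeadAt i j ∨ H.arrow j i ∨ H.line i j := by
  rcases h with h | h | h | h
  · exact Or.inl (Or.inl h)
  · exact Or.inr (Or.inl h)
  · exact Or.inl (Or.inr h)
  · exact Or.inr (Or.inr h)

namespace IsRegressionChainGraph

variable (hH : H.IsRegressionChainGraph)
include hH

theorem no_cycle {i j : V} (h : H.arrow i j) (h' : ReflTransGen H.HeadAt j i) : False :=
  hH.2 i j h h'

theorem not_headAt_of_arrow {i j : V} (h : H.arrow i j) : ¬ H.HeadAt j i := fun h' =>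
  hH.no_cycle h (.single h')

theorem not_line_of_headAt {i j k : V} (h : H.HeadAt i j) : ¬ H.line j k :=
  hH.1 i j k h

theorem arc_of_headAt {i j : V} (h : H.HeadAt i j) (h' : H.HeadAt j i) : H.arc i j := by
  rcases h with h | h
  · exact (hH.not_headAt_of_arrow h h').elim
  · exact h

/-- An edge at `j` without an arrowhead at `j` is an arrow if `j` carries an arrowhead. -/
theorem arrow_of_not_headAt {i j k : V} (h : H.HeadAt i j) (hjk : H.skeleton.Adj j k)
    (hn : ¬ H.HeadAt k j) : H.arrow j k := by
  rcases hjk with h' | h' | h' | h'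
  · exact h'
  · exact (hn (Or.inl h')).elim
  · exact (hn (Or.inr (H.arc_symm h'))).elim
  · exact (hH.not_line_of_headAt h h').elim

/-- In a triangle with edges `u *→ c → w`, the third edge points at `w`. -/
theorem headAt_of_headAt_of_arrow {u c w : V} (huc : H.HeadAt u c) (hcw : H.arrow c w)
    (huw : H.skeleton.Adj u w) : H.HeadAt u w := by
  rcases adj_cases huw with h | h | h
  · exact h
  · exact (hH.no_cycle hcw (.head (Or.inl h) (.single huc))).elim
  · exact (hH.not_line_of_headAt (Or.inl hcw) (H.line_symm h)).elim

theorem arrow_of_arrow_of_arrow {u c w : V} (huc : H.arrow u c) (hcw : H.arrow c w)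
    (huw : H.skeleton.Adj u w) : H.arrow u w := by
  rcases hH.headAt_of_headAt_of_arrow (Or.inl huc) hcw huw with h | h
  · exact h
  · exact (hH.no_cycle huc (.head (Or.inl hcw) (.single (Or.inr (H.arc_symm h))))).elim

/-- In a triangle with edges `u ↔ c ←* w`, the third edge points at `u`. -/
theorem headAt_of_arc_of_headAt {u c w : V} (huc : H.arc u c) (hwc : H.HeadAt w c)
    (huw : H.skeleton.Adj u w) : H.HeadAt w u := by
  by_contra hn
  have hcu : H.HeadAt c u := Or.inr (H.arc_symm huc)
  exact hH.no_cycle (hH.arrow_of_not_headAt hcu huw hn) (.head hwc (.single hcu))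

end IsRegressionChainGraph

/-- Colliders with order are unshielded in a regression chain graph. -/
theorem IsRegressionChainGraph.isUnshieldedCollider_of_order (hH : H.IsRegressionChainGraph)
    {h l i : V} (hc : H.IsCollider h l i) {n : ℕ} (hn : H.OrderAtMost n h l i) :
    H.IsUnshieldedCollider h l i := by
  induction n with
  | zero => exact ⟨hc, hn⟩
  | succ n ih =>
    rcases hn with hn | ⟨j, p, ⟨-, -, h3, hp⟩, rfl, rfl, -⟩
    · exact ih hn
    · obtain ⟨hcol, harr⟩ := hp (p.length - 3) (by omega)
      rw [show p.length - 3 + 1 = p.length - 2 by omega,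
        show p.length - 3 + 2 = p.length - 1 by omega] at hcol
      rw [show p.length - 3 + 1 = p.length - 2 by omega] at harr
      -- With `h` a collider on the discriminating path, `h → i`, `i *→ l` and `l *→ h` form a
      -- forbidden cycle. So only order `0` is possible.
      exact (hH.no_cycle harr (.head hc.2.2 (.single hcol.2.2))).elim

end Basic

/-! ### Collision walks, moral adjacency, and its invariance. -/

section CollisionSequences

variable {V : Type*} {H H₁ H₂ : MixedGraph V} {T : Set V}

/-- The nodes `f 0, …, f (k + 1)` form a walk whose inner nodes are all colliders in `T`. -/
structure IsCollisionSeq (H : MixedGraph V) (T : Set V) (f : ℕ → V) (k : ℕ) : Prop where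
  adj : ∀ n ≤ k, H.skeleton.Adj (f n) (f (n + 1))
  head : ∀ n < k, H.HeadAt (f n) (f (n + 1)) ∧ H.HeadAt (f (n + 2)) (f (n + 1))
  mem : ∀ n < k, f (n + 1) ∈ T

/-- There is a walk from `x` to `w` with an arrowhead at `w`, whose inner nodes are colliders,
and whose nodes apart from `x` are all in `T`. -/
inductive HalfCollision (H : MixedGraph V) (T : Set V) (x : V) : V → Prop
  | single {w : V} : H.HeadAt x w → w ∈ T → HalfCollision H T x w
  | snoc {w z : V} : HalfCollision H T x w → H.arc w z → z ∈ T → HalfCollision H T x z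

/-- There is a walk of length at least two between `x` and `y` whose inner nodes are all colliders
in `T`. -/
def Collision (H : MixedGraph V) (T : Set V) (x y : V) : Prop :=
  ∃ w, HalfCollision H T x w ∧ H.HeadAt y w

/-- The nodes `x` and `y` are adjacent in the moral graph on `T`. -/
def MoralAdj (H : MixedGraph V) (T : Set V) (x y : V) : Prop :=
  H.skeleton.Adj x y ∨ H.Collision T x y

theorem HalfCollision.mem {x w : V} (h : H.HalfCollision T x w) : w ∈ T := by
  cases h <;> assumption

theorem HalfCollision.collision {x y w : V} (hx : H.HalfCollision T x w)
    (hy : H.HalfCollision T y w) : H.Collision T x y := by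
  induction hy with
  | single h _ => exact ⟨_, hx, h⟩
  | snoc h ha _ ih => exact ih (hx.snoc (H.arc_symm ha) h.mem)

theorem Collision.symm {x y : V} (h : H.Collision T x y) : H.Collision T y x := by
  obtain ⟨w, hx, hy⟩ := h
  exact (HalfCollision.single hy hx.mem).collision hx

theorem MoralAdj.symm {x y : V} (h : H.MoralAdj T x y) : H.MoralAdj T y x :=
  h.imp (fun h => h.symm) (fun h => h.symm)

theorem IsCollisionSeq.reverse {f : ℕ → V} {k : ℕ} (h : H.IsCollisionSeq T f k) :
    H.IsCollisionSeq T (fun n => f (k + 1 - n)) k where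
  adj n hn := by
    have := h.adj (k - n) (by omega)
    rw [show k - n + 1 = k + 1 - n by omega] at this
    simpa [show k + 1 - (n + 1) = k - n by omega] using this.symm
  head n hn := by
    have := h.head (k - n - 1) (by omega)
    rw [show k - n - 1 + 1 = k - n by omega, show k - n - 1 + 2 = k + 1 - n by omega] at this
    simpa [show k + 1 - (n + 1) = k - n by omega, show k + 1 - (n + 2) = k - n - 1 by omega]
      using this.symm
  mem n hn := by
    have := h.mem (k - n - 1) (by omega)
    rw [show k - n - 1 + 1 = k - n by omega] at this
    simpa [show k + 1 - (n + 1) = k - n by omega] using this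

theorem IsCollisionSeq.arc (hH : H.IsRegressionChainGraph) {f : ℕ → V} {k : ℕ}
    (h : H.IsCollisionSeq T f k) {n : ℕ} (hn : n + 2 ≤ k) : H.arc (f (n + 1)) (f (n + 2)) :=
  hH.arc_of_headAt (h.head (n + 1) (by omega)).1 (h.head n (by omega)).2

theorem IsCollisionSeq.reflTransGen (hH : H.IsRegressionChainGraph) {f : ℕ → V} {k : ℕ}
    (h : H.IsCollisionSeq T f k) {m n : ℕ} (hmn : m ≤ n) (hn : n + 1 ≤ k) :
    ReflTransGen H.HeadAt (f (n + 1)) (f (m + 1)) := by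
  induction n, hmn using Nat.le_induction with
  | base => exact .refl
  | succ n _ ih => exact .head (Or.inr (H.arc_symm (h.arc hH hn))) (ih (by omega))

theorem IsCollisionSeq.halfCollision (hH : H.IsRegressionChainGraph) {S : Set V} {f : ℕ → V}
    {k n : ℕ} (h : H.IsCollisionSeq T f k) (hn : n + 1 ≤ k) (hS : ∀ m ≤ n, f (m + 1) ∈ S) :
    H.HalfCollision S (f 0) (f (n + 1)) := by
  induction n with
  | zero => exact .single (h.head 0 (by omega)).1 (hS 0 le_rfl)
  | succ n ih =>
    exact .snoc (ih (by omega) fun m hm => hS m (by omega)) (h.arc hH hn) (hS _ le_rfl)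

theorem IsCollisionSeq.collision (hH : H.IsRegressionChainGraph) {S : Set V} {f : ℕ → V}
    {k : ℕ} (h : H.IsCollisionSeq T f (k + 1)) (hS : ∀ m ≤ k, f (m + 1) ∈ S) :
    H.Collision S (f 0) (f (k + 2)) :=
  ⟨_, h.halfCollision hH le_rfl hS, (h.head k (by omega)).2⟩

theorem HalfCollision.exists_seq {x w : V} (h : H.HalfCollision T x w) :
    ∃ f k, f 0 = x ∧ f (k + 1) = w ∧ H.IsCollisionSeq T f k ∧ H.HeadAt (f k) (f (k + 1)) := by
  induction h with
  | @single w h _ =>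
    refine ⟨fun n => if n = 0 then x else w, 0, rfl, rfl, ⟨fun n hn => ?_, fun n hn => by omega,
      fun n hn => by omega⟩, by simpa using h⟩
    obtain rfl : n = 0 := by omega
    simpa using h.adj
  | @snoc w z h ha hz ih =>
    obtain ⟨f, k, h0, hk, hs, hh⟩ := ih
    have e : ∀ n, n ≤ k + 1 → (if n ≤ k + 1 then f n else z) = f n := fun n hn => if_pos hn
    refine ⟨fun n => if n ≤ k + 1 then f n else z, k + 1, by simpa using h0, by simp,
      ⟨fun n hn => ?_, fun n hn => ?_, fun n hn => ?_⟩, ?_⟩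
    · rcases Nat.lt_or_ge n (k + 1) with hlt | hge
      · simpa [show n ≤ k + 1 by omega, show n ≤ k by omega] using hs.adj n (by omega)
      · obtain rfl : n = k + 1 := by omega
        simpa [hk] using (HeadAt.adj (H := H) (Or.inr ha))
    · rcases Nat.lt_or_ge n k with hlt | hge
      · simpa [show n ≤ k + 1 by omega, show n ≤ k by omega, show n + 1 ≤ k by omega]
          using hs.head n hlt
      · obtain rfl : n = k := by omega
        simpa [hk] using ⟨hk ▸ hh, Or.inr (H.arc_symm ha)⟩
    · rcases Nat.lt_or_ge n k with hlt | hge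
      · simpa [show n ≤ k by omega] using hs.mem n hlt
      · obtain rfl : n = k := by omega
        simpa [hk] using h.mem
    · have : H.HeadAt w z := Or.inr ha
      simpa [hk] using this

theorem Collision.exists_seq {x y : V} (h : H.Collision T x y) :
    ∃ f k, f 0 = x ∧ f (k + 1) = y ∧ H.IsCollisionSeq T f k := by
  obtain ⟨w, hx, hy⟩ := h
  obtain ⟨f, k, h0, hk, hs, hh⟩ := hx.exists_seq
  refine ⟨fun n => if n ≤ k + 1 then f n else y, k + 1, by simpa using h0, by simp,
      ⟨fun n hn => ?_, fun n hn => ?_, fun n hn => ?_⟩⟩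
  · rcases Nat.lt_or_ge n (k + 1) with hlt | hge
    · simpa [show n ≤ k + 1 by omega, show n ≤ k by omega] using hs.adj n (by omega)
    · obtain rfl : n = k + 1 := by omega
      simpa [hk] using hy.adj.symm
  · rcases Nat.lt_or_ge n k with hlt | hge
    · simpa [show n ≤ k + 1 by omega, show n ≤ k by omega, show n + 1 ≤ k by omega]
        using hs.head n hlt
    · obtain rfl : n = k := by omega
      simpa [hk] using ⟨hk ▸ hh, hy⟩
  · rcases Nat.lt_or_ge n k with hlt | hge
    · simpa [show n ≤ k by omega] using hs.mem n hlt
    · obtain rfl : n = k := by omega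
      simpa [hk] using hx.mem

/-- A collision sequence between nonadjacent nodes can be shortened to one in which all triples
are unshielded. -/
theorem IsCollisionSeq.exists_unshielded (hH : H.IsRegressionChainGraph) {x y : V} (hxy : x ≠ y)
    (k : ℕ) : ∀ f : ℕ → V, f 0 = x → f (k + 1) = y →
    H.IsCollisionSeq T f k → ∃ g m, g 0 = x ∧ g (m + 1) = y ∧ H.IsCollisionSeq T g m ∧
      ∀ n < m, H.IsUnshieldedCollider (g n) (g (n + 1)) (g (n + 2)) := by
  induction k using Nat.strong_induction_on with
  | _ k ih =>
  intro f h0 hk hf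
  by_cases hall : ∀ n < k, H.IsUnshieldedCollider (f n) (f (n + 1)) (f (n + 2))
  · exact ⟨f, k, h0, hk, hf, hall⟩
  push Not at hall
  obtain ⟨n, hn, hns⟩ := hall
  -- A shielded triple is removed in one of two ways: a turn `⟨i, t, i⟩` loses two nodes, and a
  -- triangle loses its middle node.
  by_cases heq : f n = f (n + 2)
  · have hk2 : 2 ≤ k := by
      by_contra hlt
      obtain rfl : k = 1 := by omega
      obtain rfl : n = 0 := by omega
      exact hxy (by rw [← h0, ← hk]; exact heq)
    obtain ⟨g, hg1, hg2⟩ : ∃ g : ℕ → V, (∀ m ≤ n, g m = f m) ∧ ∀ m, n ≤ m → g m = f (m + 2) :=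
      ⟨fun m => if m ≤ n then f m else f (m + 2), fun m hm => if_pos hm, fun m hm => by
        rcases hm.eq_or_lt with rfl | hm
        · simpa using heq
        · exact if_neg (by omega)⟩
    refine ih (k - 2) (by omega) g (by rw [hg1 0 (by omega), h0]) ?_
      ⟨fun m hm => ?_, fun m hm => ?_, fun m hm => ?_⟩
    · rw [hg2 _ (by omega), show k - 2 + 1 + 2 = k + 1 by omega, hk]
    · rcases Nat.lt_or_ge m n with h | h
      · rw [hg1 m (by omega), hg1 (m + 1) (by omega)]
        exact hf.adj m (by omega)
      · rw [hg2 m (by omega), hg2 (m + 1) (by omega)]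
        exact hf.adj (m + 2) (by omega)
    · rcases Nat.lt_or_ge m n with h | h
      · refine ⟨?_, ?_⟩
        · rw [hg1 m (by omega), hg1 (m + 1) (by omega)]
          exact (hf.head m (by omega)).1
        · rcases Nat.lt_or_ge (m + 1) n with h | h
          · rw [hg1 (m + 1) (by omega), hg1 (m + 2) (by omega)]
            exact (hf.head m (by omega)).2
          · rw [hg2 (m + 1) (by omega), hg2 (m + 2) (by omega)]
            exact (hf.head (m + 2) (by omega)).2
      · rw [hg2 m (by omega), hg2 (m + 1) (by omega), hg2 (m + 2) (by omega)]
        exact hf.head (m + 2) (by omega)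
    · rcases Nat.lt_or_ge m n with h | h
      · rw [hg1 (m + 1) (by omega)]
        exact hf.mem m (by omega)
      · rw [hg2 (m + 1) (by omega)]
        exact hf.mem (m + 2) (by omega)
  · have hadj : H.skeleton.Adj (f n) (f (n + 2)) := by
      by_contra h
      exact hns ⟨⟨heq, hf.head n hn⟩, h⟩
    -- The shortcut edge needs an arrowhead only at those of its endpoints that are inner nodes of
    -- the sequence, and there the neighbouring edge on the sequence is an arc.
    have hl : 1 ≤ n → H.HeadAt (f (n + 2)) (f n) := fun h => by
      obtain ⟨n, rfl⟩ := Nat.exists_eq_add_of_le' h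
      exact hH.headAt_of_arc_of_headAt (hf.arc hH (by omega)) (hf.head (n + 1) hn).2 hadj
    have hr : n + 2 ≤ k → H.HeadAt (f n) (f (n + 2)) := fun h =>
      hH.headAt_of_arc_of_headAt (H.arc_symm (hf.arc hH h)) (hf.head n hn).1 hadj.symm
    obtain ⟨g, hg1, hg2⟩ : ∃ g : ℕ → V, (∀ m ≤ n, g m = f m) ∧ ∀ m, n < m → g m = f (m + 1) :=
      ⟨fun m => if m ≤ n then f m else f (m + 1), fun m hm => if_pos hm,
        fun m hm => if_neg (by omega)⟩
    refine ih (k - 1) (by omega) g (by rw [hg1 0 (by omega), h0]) ?_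
      ⟨fun m hm => ?_, fun m hm => ?_, fun m hm => ?_⟩
    · rw [hg2 _ (by omega), show k - 1 + 1 + 1 = k + 1 by omega, hk]
    · rcases lt_trichotomy m n with h | rfl | h
      · rw [hg1 m (by omega), hg1 (m + 1) (by omega)]
        exact hf.adj m (by omega)
      · rw [hg1 m le_rfl, hg2 (m + 1) (by omega)]
        exact hadj
      · rw [hg2 m (by omega), hg2 (m + 1) (by omega)]
        exact hf.adj (m + 1) (by omega)
    · refine ⟨?_, ?_⟩
      · rcases lt_trichotomy m n with h | rfl | h
        · rw [hg1 m (by omega), hg1 (m + 1) (by omega)]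
          exact (hf.head m (by omega)).1
        · rw [hg1 m le_rfl, hg2 (m + 1) (by omega)]
          exact hr (by omega)
        · rw [hg2 m (by omega), hg2 (m + 1) (by omega)]
          exact (hf.head (m + 1) (by omega)).1
      · rcases lt_trichotomy (m + 1) n with h | h | h
        · rw [hg1 (m + 1) (by omega), hg1 (m + 2) (by omega)]
          exact (hf.head m (by omega)).2
        · rw [hg1 (m + 1) h.le, hg2 (m + 2) (by omega), h, show m + 2 + 1 = n + 2 by omega]
          exact hl (by omega)
        · rw [hg2 (m + 1) (by omega), hg2 (m + 2) (by omega)]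
          exact (hf.head (m + 1) (by omega)).2
    · rcases Nat.lt_or_ge m n with h | h
      · rw [hg1 (m + 1) (by omega)]
        exact hf.mem m (by omega)
      · rw [hg2 (m + 1) (by omega)]
        exact hf.mem (m + 1) (by omega)

theorem Collision.exists_unshielded_seq (hH : H.IsRegressionChainGraph) {x y : V} (hxy : x ≠ y)
    (h : H.Collision T x y) :
    ∃ g m, g 0 = x ∧ g (m + 1) = y ∧ H.IsCollisionSeq T g m ∧
      ∀ n < m, H.IsUnshieldedCollider (g n) (g (n + 1)) (g (n + 2)) := by
  obtain ⟨f, k, h0, hk, hf⟩ := h.exists_seq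
  exact hf.exists_unshielded hH hxy k f h0 hk

theorem IsCollisionSeq.collision_of_not_adj (hH : H.IsRegressionChainGraph) {S : Set V}
    {f : ℕ → V} {k : ℕ} (h : H.IsCollisionSeq T f k) (hna : ¬ H.skeleton.Adj (f 0) (f (k + 1)))
    (hS : ∀ m < k, f (m + 1) ∈ S) : H.Collision S (f 0) (f (k + 1)) := by
  cases k with
  | zero => exact (hna (h.adj 0 le_rfl)).elim
  | succ k => exact h.collision hH fun m hm => hS m (by omega)

/-- The two graphs have the same skeleton and the same unshielded colliders. -/
structure SameUnshielded (H₁ H₂ : MixedGraph V) : Prop where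
  skeleton : H₁.skeleton = H₂.skeleton
  collider : ∀ i t j, H₁.IsUnshieldedCollider i t j ↔ H₂.IsUnshieldedCollider i t j

theorem SameUnshielded.symm (h : SameUnshielded H₁ H₂) : SameUnshielded H₂ H₁ :=
  ⟨h.1.symm, fun i t j => (h.2 i t j).symm⟩

theorem SameUnshielded.isCollisionSeq (h : SameUnshielded H₁ H₂) {f : ℕ → V} {k : ℕ}
    (hf : H₁.IsCollisionSeq T f k)
    (hu : ∀ n < k, H₁.IsUnshieldedCollider (f n) (f (n + 1)) (f (n + 2))) :
    H₂.IsCollisionSeq T f k :=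
  ⟨fun n hn => h.skeleton ▸ hf.adj n hn, fun n hn => ((h.collider _ _ _).1 (hu n hn)).1.2, hf.mem⟩

/-- After shortening, a collision sequence consists of unshielded colliders only, so it is also a
collision sequence in the other graph, with inner nodes still in `T`. -/
theorem SameUnshielded.moralAdj (h : SameUnshielded H₁ H₂) (h₁ : H₁.IsRegressionChainGraph)
    (h₂ : H₂.IsRegressionChainGraph) {x y : V} (hxy : x ≠ y) (hm : H₁.MoralAdj T x y) :
    H₂.MoralAdj T x y := by
  by_cases hna : H₁.skeleton.Adj x y
  · exact Or.inl (h.skeleton ▸ hna)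
  · obtain ⟨g, m, rfl, rfl, hg, hu⟩ := (hm.resolve_left hna).exists_unshielded_seq h₁ hxy
    exact Or.inr ((h.isCollisionSeq hg hu).collision_of_not_adj h₂ (h.skeleton ▸ hna) hg.mem)

end CollisionSequences

/-! ### Deleting sinks of one graph from a set with exits in the other. -/

section Removal

variable {V : Type*} {H H₁ H₂ : MixedGraph V} {T U C : Set V}

/-- Every node of `T` outside `U` has an arrow into `T` or is an endpoint of a line. -/
def HasExits (H : MixedGraph V) (T U : Set V) : Prop :=
  ∀ u ∈ T, u ∉ U → (∃ w ∈ T, H.arrow u w) ∨ ∃ w, H.line u w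

/-- The node `v` has no arrow into `T` and is not an endpoint of a line. -/
def IsSink (H : MixedGraph V) (T : Set V) (v : V) : Prop :=
  (∀ w ∈ T, ¬ H.arrow v w) ∧ ∀ w, ¬ H.line v w

/-- `x` and `y` are connected in the moral graph on `T` by a walk outside `C`. -/
def MoralReachable (H : MixedGraph V) (T C : Set V) : V → V → Prop :=
  ReflTransGen fun x y => (x ∈ T \ C ∧ y ∈ T \ C) ∧ H.MoralAdj T x y

theorem IsSink.headAt {u v : V} (hv : H.IsSink T v) (hu : u ∈ T) (h : H.skeleton.Adj u v) :
    H.HeadAt u v := by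
  rcases adj_cases h with h | h | h
  · exact h
  · exact (hv.1 u hu h).elim
  · exact (hv.2 u (H.line_symm h)).elim

/-- If the deleted `v` was the exit of `u`, then `u → v → z` in `H₁` for some `z ∈ T`, and `z`
becomes the new exit. The nodes `u` and `z` are adjacent, because otherwise `⟨u, v, z⟩` would be an
unshielded collider in `H₂`, where `v` is a sink, but not in `H₁`. -/
theorem SameUnshielded.hasExits_diff (h : SameUnshielded H₁ H₂)
    (h₁ : H₁.IsRegressionChainGraph) {v : V} (hT : H₁.HasExits T U) (hvU : v ∉ U) (hvT : v ∈ T)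
    (hv : H₂.IsSink T v) : H₁.HasExits (T \ {v}) U := by
  rintro u ⟨hu, huv⟩ huU
  rcases hT u hu huU with ⟨w, hw, huw⟩ | hl
  · by_cases hwv : w = v
    · subst hwv
      rcases hT w hvT hvU with ⟨z, hz, hwz⟩ | ⟨z, hwz⟩
      · have hzw : z ≠ w := (HeadAt.ne (H := H₁) (Or.inl hwz)).symm
        refine Or.inl ⟨z, ⟨hz, hzw⟩, h₁.arrow_of_arrow_of_arrow huw hwz ?_⟩
        by_contra hna
        have huz : u ≠ z := by
          rintro rfl
          exact h₁.not_headAt_of_arrow huw (Or.inl hwz)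
        have hc : H₂.IsUnshieldedCollider u w z :=
          ⟨⟨huz, hv.headAt hu (h.skeleton ▸ HeadAt.adj (Or.inl huw)),
            hv.headAt hz (h.skeleton ▸ (HeadAt.adj (Or.inl hwz)).symm)⟩, h.skeleton ▸ hna⟩
        exact h₁.not_headAt_of_arrow hwz ((h.collider _ _ _).2 hc).1.2.2
      · exact (h₁.not_line_of_headAt (Or.inl huw) hwz).elim
    · exact Or.inl ⟨w, ⟨hw, hwv⟩, huw⟩
  · exact Or.inr hl

/-- The part of a collision path before a sink `v` of `T` in `H₂` can be turned towards a child
`w` of `v` in `H₁`. -/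
theorem SameUnshielded.halfCollision_diff (h : SameUnshielded H₁ H₂)
    (h₁ : H₁.IsRegressionChainGraph) (h₂ : H₂.IsRegressionChainGraph) {v w : V}
    (hv : H₂.IsSink T v) (hw : w ∈ T) (hvw : H₁.arrow v w) {f : ℕ → V} {k i : ℕ}
    (hf : H₁.IsCollisionSeq T f k)
    (hu : ∀ n < k, H₁.IsUnshieldedCollider (f n) (f (n + 1)) (f (n + 2))) (hi : i < k)
    (h0 : f 0 ∈ T) (hfv : f (i + 1) = v) (hmin : ∀ m < i, f (m + 1) ≠ v) :
    H₁.HalfCollision (T \ {v}) (f 0) w := by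
  have hf₂ := h.isCollisionSeq hf hu
  have hwv : w ≠ v := (HeadAt.ne (H := H₁) (Or.inl hvw)).symm
  have hmem : ∀ n ≤ k, f n ∈ T := fun n hn => by
    cases n with
    | zero => exact h0
    | succ n => exact hf.mem n hn
  have hwv₂ : H₂.HeadAt w v := hv.headAt hw (h.skeleton ▸ (HeadAt.adj (Or.inl hvw)).symm)
  have step : ∀ j ≤ i, H₁.HeadAt (f j) w → H₁.HalfCollision (T \ {v}) (f 0) w := by
    intro j
    induction j with
    | zero => exact fun _ hj => .single hj ⟨hw, hwv⟩
    | succ j ih =>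
      intro hj hjw
      -- An arc into `w` completes the walk. An arrow `f (j + 1) → w` hands the arrowhead at `w`
      -- back to `f j`. Were `f j` and `w` not adjacent, `f (j + 1) → w` would hold in `H₂` too and
      -- close a cycle through `w *→ v` and the arcs from `v` back to `f (j + 1)`.
      rcases hjw with hjw | hjw
      · refine ih (by omega) (h₁.headAt_of_headAt_of_arrow (hf.head j (by omega)).1 hjw ?_)
        by_contra hna
        have hne : f j ≠ w := by
          rintro rfl
          exact h₁.not_headAt_of_arrow hjw (hf.head j (by omega)).1
        have hw₂ : ¬ H₂.HeadAt w (f (j + 1)) := fun hh =>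
          h₁.not_headAt_of_arrow hjw ((h.collider _ _ _).2
            ⟨⟨hne, (hf₂.head j (by omega)).1, hh⟩, h.skeleton ▸ hna⟩).1.2.2
        have harr : H₂.arrow (f (j + 1)) w := h₂.arrow_of_not_headAt (hf₂.head j (by omega)).1
          (h.skeleton ▸ HeadAt.adj (Or.inl hjw)) hw₂
        refine h₂.no_cycle harr (.head hwv₂ ?_)
        rw [← hfv]
        exact hf₂.reflTransGen h₂ (by omega) (by omega)
      · exact .snoc (hf.halfCollision h₁ (S := T \ {v}) (by omega) fun m hm =>
          ⟨hf.mem m (by omega), hmin m (by omega)⟩) hjw ⟨hw, hwv⟩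
  have hiv : H₁.HeadAt (f i) v := hfv ▸ (hf.head i hi).1
  refine step i le_rfl (h₁.headAt_of_headAt_of_arrow hiv hvw ?_)
  by_contra hna
  have hne : f i ≠ w := by
    rintro rfl
    exact h₁.not_headAt_of_arrow hvw hiv
  exact h₁.not_headAt_of_arrow hvw ((h.collider _ _ _).2
    ⟨⟨hne, hfv ▸ (hf₂.head i hi).1, hwv₂⟩, h.skeleton ▸ hna⟩).1.2.2

/-- A collision path through `v` has an arrowhead at `v`, so the exit of `v` in `H₁` is an arrow `v
→ w`. Both ends of the path can be turned towards `w` without meeting `v`, and the two halves join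
at `w`. -/
theorem SameUnshielded.moralAdj_diff (h : SameUnshielded H₁ H₂)
    (h₁ : H₁.IsRegressionChainGraph) (h₂ : H₂.IsRegressionChainGraph) {v : V}
    (hT : H₁.HasExits T U) (hvU : v ∉ U) (hvT : v ∈ T) (hv : H₂.IsSink T v) {x y : V}
    (hx : x ∈ T) (hy : y ∈ T) (hxy : x ≠ y) (hm : H₁.MoralAdj T x y) :
    H₁.MoralAdj (T \ {v}) x y := by
  by_cases hna : H₁.skeleton.Adj x y
  · exact Or.inl hna
  obtain ⟨f, k, rfl, rfl, hf, hu⟩ := (hm.resolve_left hna).exists_unshielded_seq h₁ hxy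
  right
  by_cases hex : ∃ i, i < k ∧ f (i + 1) = v
  · obtain ⟨i, ⟨hi, hfi⟩, hmin⟩ : ∃ i, (i < k ∧ f (i + 1) = v) ∧ ∀ m < i, f (m + 1) ≠ v := by
      classical
      exact ⟨Nat.find hex, Nat.find_spec hex, fun m hm hmv => Nat.find_min hex hm
        ⟨by have := (Nat.find_spec hex).1; omega, hmv⟩⟩
    rcases hT v hvT hvU with ⟨w, hw, hvw⟩ | ⟨w, hvw⟩
    · have hl := h.halfCollision_diff h₁ h₂ hv hw hvw hf hu hi hx hfi hmin
      -- The other half is cut at the last visit to `v`, which is the first visit of the reversed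
      -- sequence.
      have hex' : ∃ i, i < k ∧ f (k + 1 - (i + 1)) = v :=
        ⟨k - (i + 1), by omega, by rw [show k + 1 - (k - (i + 1) + 1) = i + 1 by omega, hfi]⟩
      obtain ⟨i', ⟨hi', hfi'⟩, hmin'⟩ : ∃ i, (i < k ∧ f (k + 1 - (i + 1)) = v) ∧
          ∀ m < i, f (k + 1 - (m + 1)) ≠ v := by
        classical
        exact ⟨Nat.find hex', Nat.find_spec hex', fun m hm hmv => Nat.find_min hex' hm
          ⟨by have := (Nat.find_spec hex').1; omega, hmv⟩⟩
      have hr := h.halfCollision_diff h₁ h₂ hv hw hvw hf.reverse (fun n hn => ?_) hi'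
        (by simpa using hy) hfi' hmin'
      · exact hl.collision (by simpa using hr)
      · obtain ⟨⟨hne, ha, hb⟩, hn⟩ := hu (k - n - 1) (by omega)
        rw [show k - n - 1 + 1 = k - n by omega] at ha hb
        rw [show k - n - 1 + 2 = k + 1 - n by omega] at hne hb hn
        rw [show k + 1 - (n + 1) = k - n by omega, show k + 1 - (n + 2) = k - n - 1 by omega]
        exact ⟨⟨hne.symm, hb, ha⟩, fun h => hn h.symm⟩
    · exact (h₁.not_line_of_headAt (hfi ▸ (hf.head i hi).1) hvw).elim
  · push Not at hex
    exact hf.collision_of_not_adj h₁ hna fun m hm => ⟨hf.mem m hm, hex m hm⟩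

/-- Every edge between `T` and a sink has an arrowhead at the sink, so the last edge of a collision
walk ending there is an arc. -/
theorem IsSink.halfCollision (hH : H.IsRegressionChainGraph) {x v : V} (hv : H.IsSink T v)
    (hvT : v ∈ T) (hx : x ∈ T) (h : H.MoralAdj T x v) : H.HalfCollision T x v := by
  rcases h with h | ⟨w, hw, hvw⟩
  · exact .single (hv.headAt hx h) hvT
  · refine .snoc hw ?_ hvT
    exact hH.arc_of_headAt (hv.headAt hw.mem hvw.adj.symm) hvw

/-- A sink of `T` in `H₂` that has an exit in `H₁` is not needed in moral walks. -/
theorem SameUnshielded.moralReachable_diff (h : SameUnshielded H₁ H₂)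
    (h₁ : H₁.IsRegressionChainGraph) (h₂ : H₂.IsRegressionChainGraph) {v : V}
    (hT : H₁.HasExits T U) (hvU : v ∉ U) (hvT : v ∈ T) (hv : H₂.IsSink T v) {a b : V}
    (ha : a ≠ v) (hb : b ≠ v) (hab : H₂.MoralReachable T C a b) :
    H₂.MoralReachable (T \ {v}) C a b := by
  -- A moral edge of `H₂` on `T` is carried to `H₁`, where `v` can be avoided, and then back to
  -- `H₂`.
  have edge : ∀ {x y : V}, x ∈ T \ C → y ∈ T \ C → x ≠ v → y ≠ v → H₂.MoralAdj T x y →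
      H₂.MoralReachable (T \ {v}) C x y := by
    intro x y hx hy hxv hyv hm
    by_cases hxy : x = y
    · subst hxy
      exact .refl
    · refine .single ⟨⟨⟨⟨hx.1, hxv⟩, hx.2⟩, ⟨hy.1, hyv⟩, hy.2⟩, ?_⟩
      exact h.moralAdj h₁ h₂ hxy (h.moralAdj_diff h₁ h₂ hT hvU hvT hv hx.1 hy.1 hxy
        (h.symm.moralAdj h₂ h₁ hxy hm))
  -- While the walk is at `v`, its last node `x ≠ v` is kept. On leaving `v`, that node and the next
  -- one are joined by a collision walk through the sink `v`.
  have key : (b ≠ v → H₂.MoralReachable (T \ {v}) C a b) ∧ (b = v → ∃ x ∈ T \ C, x ≠ v ∧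
      H₂.MoralReachable (T \ {v}) C a x ∧ H₂.MoralAdj T x v) := by
    clear hb
    induction hab with
    | refl => exact ⟨fun _ => .refl, fun h => (ha h).elim⟩
    | @tail c d hac hcd ih =>
      obtain ⟨⟨hc, hd⟩, hcd⟩ := hcd
      by_cases hcv : c = v
      · obtain ⟨x, hx, hxv, hax, hm⟩ := ih.2 hcv
        refine ⟨fun hdv => ?_, fun hdv => ⟨x, hx, hxv, hax, hm⟩⟩
        subst hcv
        exact hax.trans (edge hx hd hxv hdv (Or.inr ((hv.halfCollision h₂ hvT hx.1 hm).collision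
          (hv.halfCollision h₂ hvT hd.1 hcd.symm))))
      · exact ⟨fun hdv => (ih.1 hcv).trans (edge hc hd hcv hdv hcd),
          fun hdv => ⟨c, hc, hcv, ih.1 hcv, hdv ▸ hcd⟩⟩
  exact key.1 hb

/-- Moral walks in `T` can be moved to a subset on which `H₂` has exits, too. -/
theorem SameUnshielded.exists_hasExits [Finite V] (h : SameUnshielded H₁ H₂)
    (h₁ : H₁.IsRegressionChainGraph) (h₂ : H₂.IsRegressionChainGraph) {a b : V} (ha : a ∈ U)
    (hb : b ∈ U) (n : ℕ) : ∀ T : Set V, T.ncard = n → U ⊆ T → H₁.HasExits T U →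
    H₂.MoralReachable T C a b →
    ∃ S, U ⊆ S ∧ H₂.HasExits S U ∧ H₂.MoralReachable S C a b := by
  induction n with
  | zero =>
    intro T hT hUT
    rw [(Set.ncard_eq_zero).1 hT] at hUT
    exact (hUT ha).elim
  | succ n ih =>
    intro T hcard hUT hT hab
    by_cases hT₂ : H₂.HasExits T U
    · exact ⟨T, hUT, hT₂, hab⟩
    · simp only [HasExits, not_forall, not_or, not_exists, not_and] at hT₂
      obtain ⟨v, hvT, hvU, hv⟩ := hT₂
      refine ih (T \ {v}) ?_ (fun u hu => ⟨hUT hu, ?_⟩) (h.hasExits_diff h₁ hT hvU hvT hv)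
        (h.moralReachable_diff h₁ h₂ hT hvU hvT hv ?_ ?_ hab)
      · rw [Set.ncard_sdiff_singleton_of_mem hvT, hcard, Nat.add_sub_cancel]
      · rintro rfl; exact hvU hu
      · rintro rfl; exact hvU ha
      · rintro rfl; exact hvU hb

end Removal

/-! ### Connecting walks and moral walks on sets with exits. -/

section Connection

variable {V : Type*} {H H₁ H₂ : MixedGraph V} {T U A B C : Set V}

/-- The walk `f 0, …, f N` is `m`-connecting given `C`, where a turn `⟨i, t, i⟩` counts as a
collider if the edge has an arrowhead at `t`. -/
structure IsConnectingSeq (H : MixedGraph V) (C : Set V) (f : ℕ → V) (N : ℕ) : Prop where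
  adj : ∀ n < N, H.skeleton.Adj (f n) (f (n + 1))
  collider : ∀ n, n + 2 ≤ N → H.HeadAt (f n) (f (n + 1)) → H.HeadAt (f (n + 2)) (f (n + 1)) →
    f (n + 1) ∈ C ∪ H.ancestors C
  noncollider : ∀ n, n + 2 ≤ N →
    ¬ (H.HeadAt (f n) (f (n + 1)) ∧ H.HeadAt (f (n + 2)) (f (n + 1))) → f (n + 1) ∉ C

theorem mem_ancestors_of_transGen {a b : V} (h : TransGen H.arrow a b)
    (hb : b ∈ C ∪ H.ancestors C) : a ∈ H.ancestors C := by
  rcases hb with hb | ⟨c, hc, hbc⟩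
  · exact ⟨b, hb, h⟩
  · exact ⟨c, hc, h.trans hbc⟩

theorem mem_ancestors_of_arrow {a b : V} (h : H.arrow a b) (hb : b ∈ C ∪ H.ancestors C) :
    a ∈ H.ancestors C :=
  mem_ancestors_of_transGen (.single h) hb

theorem IsRegressionChainGraph.not_transGen_self (hH : H.IsRegressionChainGraph) {v : V} :
    ¬ TransGen H.arrow v v := fun h => by
  obtain ⟨w, hvw, hwv⟩ := TransGen.head'_iff.1 h
  exact hH.no_cycle hvw (ReflTransGen.mono (fun _ _ h => Or.inl h) _ _ hwv)

theorem IsRegressionChainGraph.wellFounded_arrow [Finite V] (hH : H.IsRegressionChainGraph) :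
    WellFounded (fun a b => H.arrow b a) := by
  have : IsTrans V fun a b => TransGen H.arrow b a := ⟨fun _ _ _ h h' => h'.trans h⟩
  have : Std.Irrefl fun a b => TransGen H.arrow b a := ⟨fun _ => hH.not_transGen_self⟩
  exact Subrelation.wf (fun h => TransGen.single h)
    (Finite.wellFounded_of_trans_of_irrefl fun a b => TransGen H.arrow b a)

/-- Cutting out a closed subwalk keeps a walk connecting. -/
theorem IsConnectingSeq.exists_shorter (hH : H.IsRegressionChainGraph) {f : ℕ → V} {N p q : ℕ}
    (hf : H.IsConnectingSeq C f N) (hpq : p < q) (hq : q ≤ N) (heq : f p = f q) :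
    ∃ g M, M < N ∧ g 0 = f 0 ∧ g M = f N ∧ H.IsConnectingSeq C g M := by
  obtain ⟨d, rfl⟩ := Nat.exists_eq_add_of_lt hpq
  set e := d + 1
  rw [add_assoc] at heq hq
  obtain ⟨g, hg1, hg2⟩ : ∃ g : ℕ → V, (∀ m ≤ p, g m = f m) ∧ ∀ m, p ≤ m → g m = f (m + e) :=
    ⟨fun m => if m ≤ p then f m else f (m + e), fun m hm => if_pos hm, fun m hm => by
      rcases hm.eq_or_lt with rfl | hm
      · simpa using heq
      · exact if_neg (by omega)⟩
  -- Suppose the merged node becomes a collider outside `C ∪ an(C)`. Then the closed subwalk must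
  -- leave it by an arrow, and it can never meet a collider, which would make the node an ancestor
  -- of `C`. So the subwalk is a directed cycle.
  have hcol : ∀ m, m + 1 = p → p + e + 1 ≤ N → H.HeadAt (f m) (f p) →
      H.HeadAt (f (p + e + 1)) (f p) → f p ∈ C ∪ H.ancestors C := by
    rintro m rfl hN hl hr
    by_contra hv
    have walk : ∀ n, m + 1 ≤ n → n < m + 1 + e →
        H.arrow (f n) (f (n + 1)) ∧ TransGen H.arrow (f (m + 1)) (f (n + 1)) := by
      intro n hn
      induction n, hn using Nat.le_induction with
      | base =>
        intro _
        have : H.arrow (f (m + 1)) (f (m + 2)) :=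
          hH.arrow_of_not_headAt hl (hf.adj (m + 1) (by omega))
            fun hh => hv (hf.collider m (by omega) hl hh)
        exact ⟨this, .single this⟩
      | succ n hn ih =>
        intro hlt
        obtain ⟨ha, ht⟩ := ih (by omega)
        have : H.arrow (f (n + 1)) (f (n + 2)) :=
          hH.arrow_of_not_headAt (Or.inl ha) (hf.adj (n + 1) (by omega)) fun hh =>
            hv (Or.inr (mem_ancestors_of_transGen ht
              (hf.collider n (by omega) (Or.inl ha) hh)))
        exact ⟨this, ht.tail this⟩
    have := (walk (m + e) (by omega) (by omega)).2
    rw [show m + e + 1 = m + 1 + e by omega, ← heq] at this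
    exact hH.not_transGen_self this
  -- An outer edge without an arrowhead at the merged node already made one of the two original
  -- visits a non-collider.
  have hnon : ∀ m, m + 1 = p → p + e + 1 ≤ N →
      ¬ (H.HeadAt (f m) (f p) ∧ H.HeadAt (f (p + e + 1)) (f p)) → f p ∉ C := by
    rintro m rfl hN hn hC
    refine hn ⟨?_, ?_⟩
    · by_contra hh
      exact hf.noncollider m (by omega) (fun h => hh h.1) hC
    · by_contra hh
      refine hf.noncollider (m + e) (by omega) (fun h => hh ?_) ?_
      · rw [heq, show m + 1 + e = m + e + 1 by omega]
        exact h.2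
      · rwa [show m + e + 1 = m + 1 + e by omega, ← heq]
  refine ⟨g, N - e, by omega, hg1 0 (by omega), ?_, fun m hm => ?_, fun m hm => ?_,
    fun m hm => ?_⟩
  · rw [hg2 _ (by omega), Nat.sub_add_cancel (by omega)]
  · rcases Nat.lt_or_ge m p with h | h
    · rw [hg1 m (by omega), hg1 (m + 1) (by omega)]
      exact hf.adj m (by omega)
    · rw [hg2 m (by omega), hg2 (m + 1) (by omega), add_right_comm]
      exact hf.adj (m + e) (by omega)
  · rcases lt_trichotomy (m + 1) p with h | h | h
    · rw [hg1 m (by omega), hg1 (m + 1) (by omega), hg1 (m + 2) (by omega)]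
      exact hf.collider m (by omega)
    · rw [hg1 m (by omega), hg1 (m + 1) (by omega), hg2 (m + 2) (by omega),
        show m + 2 + e = p + e + 1 by omega, h]
      exact hcol m h (by omega)
    · rw [hg2 m (by omega), hg2 (m + 1) (by omega), hg2 (m + 2) (by omega),
        add_right_comm, add_right_comm m 2]
      exact hf.collider (m + e) (by omega)
  · rcases lt_trichotomy (m + 1) p with h | h | h
    · rw [hg1 m (by omega), hg1 (m + 1) (by omega), hg1 (m + 2) (by omega)]
      exact hf.noncollider m (by omega)
    · rw [hg1 m (by omega), hg1 (m + 1) (by omega), hg2 (m + 2) (by omega),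
        show m + 2 + e = p + e + 1 by omega, h]
      exact hnon m h (by omega)
    · rw [hg2 m (by omega), hg2 (m + 1) (by omega), hg2 (m + 2) (by omega),
        add_right_comm, add_right_comm m 2]
      exact hf.noncollider (m + e) (by omega)

theorem _root_.SimpleGraph.exists_walk_getVert (G : SimpleGraph V) (N : ℕ) : ∀ f : ℕ → V,
    (∀ n < N, G.Adj (f n) (f (n + 1))) →
    ∃ p : G.Walk (f 0) (f N), p.length = N ∧ ∀ n ≤ N, p.getVert n = f n := by
  induction N with
  | zero =>
    intro f _
    exact ⟨.nil, rfl, fun n hn => by obtain rfl : n = 0 := by omega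
                                     rfl⟩
  | succ N ih =>
    intro f hf
    obtain ⟨p, hp, hpf⟩ := ih (fun n => f (n + 1)) fun n hn => hf (n + 1) (by omega)
    refine ⟨.cons (hf 0 (by omega)) p, by simp [hp], fun n hn => ?_⟩
    cases n with
    | zero => rfl
    | succ n => exact hpf n (by omega)

/-- Cutting out closed subwalks until no node repeats also removes all turns `⟨i, t, i⟩`, so the
walk and path notions of collider then agree. -/
theorem IsConnectingSeq.exists_isMConnecting (hH : H.IsRegressionChainGraph) (N : ℕ) :
    ∀ f : ℕ → V, H.IsConnectingSeq C f N →
      ∃ p : H.skeleton.Walk (f 0) (f N), H.IsMConnecting C p := by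
  induction N using Nat.strong_induction_on with
  | _ N ih =>
  intro f hf
  by_cases hinj : ∃ p q, p < q ∧ q ≤ N ∧ f p = f q
  · obtain ⟨p, q, hpq, hq, heq⟩ := hinj
    obtain ⟨g, M, hM, h0, hN, hg⟩ := hf.exists_shorter hH hpq hq heq
    rw [← h0, ← hN]
    exact ih M hM g hg
  · push Not at hinj
    obtain ⟨p, hp, hpf⟩ := H.skeleton.exists_walk_getVert N f hf.adj
    refine ⟨p, (SimpleGraph.Walk.IsPath.getVert_injOn_iff p).1 fun m hm n hn h => ?_,
      fun n hn => ?_⟩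
    · rw [Set.mem_ofPred, hp] at hm hn
      rw [hpf m hm, hpf n hn] at h
      rcases lt_trichotomy m n with hlt | rfl | hlt
      · exact (hinj m n hlt hn h).elim
      · rfl
      · exact (hinj n m hlt hm h.symm).elim
    · rw [hp] at hn
      rw [hpf n (by omega), hpf (n + 1) (by omega), hpf (n + 2) hn]
      exact ⟨fun h => hf.collider n hn h.2.1 h.2.2, fun h => hf.noncollider n hn fun h' =>
        h ⟨hinj n (n + 2) (by omega) hn, h'⟩⟩

/-- `m`-connecting walks from `A`: such a walk reaches `u`, and `h` tells whether its last edge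
has an arrowhead at `u`. -/
inductive ReachedFrom (H : MixedGraph V) (A C : Set V) : V → Prop → Prop
  | start {a : V} : a ∈ A → ReachedFrom H A C a False
  | step {u w : V} {h : Prop} : ReachedFrom H A C u h → H.skeleton.Adj u w →
      (h → H.HeadAt w u → u ∈ C ∪ H.ancestors C) → (¬ (h ∧ H.HeadAt w u) → u ∉ C) →
      ReachedFrom H A C w (H.HeadAt u w)

theorem ReachedFrom.exists_seq {u : V} {h : Prop} (hr : H.ReachedFrom A C u h) :
    ∃ f N, f 0 ∈ A ∧ f N = u ∧ H.IsConnectingSeq C f N ∧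
      ∀ n, n + 1 = N → (h ↔ H.HeadAt (f n) (f (n + 1))) := by
  induction hr with
  | @start a ha => exact ⟨fun _ => a, 0, ha, rfl, ⟨by simp, by simp, by simp⟩, by simp⟩
  | @step u w h _ hadj hc hn ih =>
    obtain ⟨f, N, h0, hN, hf, hh⟩ := ih
    obtain ⟨g, hg1, hg2⟩ : ∃ g : ℕ → V, (∀ m ≤ N, g m = f m) ∧ g (N + 1) = w :=
      ⟨fun m => if m ≤ N then f m else w, fun m hm => if_pos hm, by simp⟩
    refine ⟨g, N + 1, by rwa [hg1 0 (by omega)], hg2,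
      ⟨fun n hn => ?_, fun n hn => ?_, fun n hn => ?_⟩, fun n hn => ?_⟩
    · rcases Nat.lt_or_ge n N with hlt | hge
      · rw [hg1 n (by omega), hg1 (n + 1) (by omega)]
        exact hf.adj n hlt
      · obtain rfl : n = N := by omega
        rwa [hg1 n le_rfl, hg2, hN]
    · rcases Nat.lt_or_ge (n + 1) N with hlt | hge
      · rw [hg1 n (by omega), hg1 (n + 1) (by omega), hg1 (n + 2) (by omega)]
        exact hf.collider n hlt
      · obtain rfl : N = n + 1 := by omega
        rw [hg1 n (by omega), hg1 (n + 1) (by omega), hg2, ← hh n rfl, hN]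
        exact hc
    · rcases Nat.lt_or_ge (n + 1) N with hlt | hge
      · rw [hg1 n (by omega), hg1 (n + 1) (by omega), hg1 (n + 2) (by omega)]
        exact hf.noncollider n hlt
      · obtain rfl : N = n + 1 := by omega
        rw [hg1 n (by omega), hg1 (n + 1) (by omega), hg2, ← hh n rfl, hN]
        assumption
    · obtain rfl : n = N := by omega
      rw [hg1 n le_rfl, hg2, hN]

theorem ReachedFrom.not_mSep (hH : H.IsRegressionChainGraph) {b : V} {h : Prop} (hb : b ∈ B)
    (hr : H.ReachedFrom A C b h) : ¬ H.MSep A B C := by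
  obtain ⟨f, N, h0, rfl, hf, -⟩ := hr.exists_seq
  obtain ⟨p, hp⟩ := hf.exists_isMConnecting hH
  exact fun hs => hs _ h0 _ hb p hp

theorem ReachedFrom.not_of_line (hH : H.IsRegressionChainGraph) {u z : V} {h : Prop}
    (hr : H.ReachedFrom A C u h) (hl : H.line u z) : ¬ h := by
  cases hr with
  | start => exact id
  | step => exact fun hh => hH.not_line_of_headAt hh hl

/-- A node of `T` that is no ancestor of `C` can be left by any edge, after a detour to `A`. -/
theorem ReachedFrom.exists_not_head [Finite V] (hH : H.IsRegressionChainGraph)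
    (hT : H.HasExits T (A ∪ B ∪ C)) (hs : H.MSep A B C) {u : V} (hu : u ∈ T)
    (huC : u ∉ C ∪ H.ancestors C) {h : Prop} (hr : H.ReachedFrom A C u h) :
    ∃ h' : Prop, ¬ h' ∧ H.ReachedFrom A C u h' := by
  by_cases hl : ∃ z, H.line u z
  · exact ⟨h, hr.not_of_line hH hl.choose_spec, hr⟩
  -- Exits are followed downwards from `u`. They cannot enter `C`, and no line occurs below an
  -- arrow. If the descent ends in `B`, it extends every walk reaching `u` to a connecting one. If
  -- it ends in `A`, climbing back along the arrows reaches `u` without an arrowhead.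
  have key : (∀ h, H.ReachedFrom A C u h → ∃ b ∈ B, ∃ h', H.ReachedFrom A C b h') ∨
      ∃ h' : Prop, ¬ h' ∧ H.ReachedFrom A C u h' := by
    clear hr
    induction u using hH.wellFounded_arrow.induction with
    | _ u ih =>
    by_cases huU : u ∈ A ∪ B ∪ C
    · rcases huU with (huA | huB) | hC
      · exact Or.inr ⟨False, id, .start huA⟩
      · exact Or.inl fun h hr => ⟨u, huB, h, hr⟩
      · exact (huC (Or.inl hC)).elim
    · obtain ⟨w, hw, huw⟩ := (hT u hu huU).resolve_right hl
      have hwC : w ∉ C ∪ H.ancestors C := fun hh => huC (Or.inr (mem_ancestors_of_arrow huw hh))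
      have hadj : H.skeleton.Adj u w := HeadAt.adj (Or.inl huw)
      rcases ih w huw hw hwC fun ⟨z, hz⟩ => hH.not_line_of_headAt (Or.inl huw) hz with hd | hd
      · exact Or.inl fun h hr => hd _ (hr.step hadj
          (fun _ hh => (hH.not_headAt_of_arrow huw hh).elim) fun _ hh => huC (Or.inl hh))
      · obtain ⟨h', hn, hr⟩ := hd
        exact Or.inr ⟨_, hH.not_headAt_of_arrow huw, hr.step hadj.symm (fun hh => (hn hh).elim)
          fun _ hh => hwC (Or.inl hh)⟩
  rcases key with hk | hk
  · obtain ⟨b, hb, h', hr'⟩ := hk h hr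
    exact (hr'.not_mSep hH hb hs).elim
  · exact hk

/-- A node of `an(C)` outside `C` may be passed either as a collider or as a non-collider. Any other
node outside `C` is first reached anew without an arrowhead, which makes it a non-collider. The
detour leaves the new last edge unchanged, so the recorded arrowhead is still that of the edge from
`u` to `w`. -/
theorem ReachedFrom.step_of_notMem [Finite V] (hH : H.IsRegressionChainGraph)
    (hT : H.HasExits T (A ∪ B ∪ C)) (hs : H.MSep A B C) {u w : V} (hu : u ∈ T)
    (huC : u ∉ C) {h : Prop} (hr : H.ReachedFrom A C u h) (huw : H.skeleton.Adj u w) :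
    H.ReachedFrom A C w (H.HeadAt u w) := by
  by_cases hK : u ∈ C ∪ H.ancestors C
  · exact hr.step huw (fun _ _ => hK) fun _ => huC
  · obtain ⟨h', hn, hr'⟩ := hr.exists_not_head hH hT hs hu hK
    exact hr'.step huw (fun hh => (hn hh).elim) fun _ => huC

theorem ReachedFrom.step_of_head [Finite V] (hH : H.IsRegressionChainGraph)
    (hT : H.HasExits T (A ∪ B ∪ C)) (hs : H.MSep A B C) {u w : V} (hu : u ∈ T)
    {h : Prop} (hh : h) (hr : H.ReachedFrom A C u h) (hwu : H.HeadAt w u) :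
    H.ReachedFrom A C w (H.HeadAt u w) := by
  by_cases hC : u ∈ C
  · exact hr.step hwu.adj.symm (fun _ _ => Or.inl hC) fun hn => (hn ⟨hh, hwu⟩).elim
  · exact hr.step_of_notMem hH hT hs hu hC hwu.adj.symm

/-- If all nodes of `T` have exits, then `m`-separation implies separation in the moral graph. -/
theorem MoralReachable.not_mSep [Finite V] (hH : H.IsRegressionChainGraph)
    (hT : H.HasExits T (A ∪ B ∪ C)) {a b : V} (ha : a ∈ A) (hb : b ∈ B)
    (hab : H.MoralReachable T C a b) : ¬ H.MSep A B C := by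
  intro hs
  have key : ∃ h, H.ReachedFrom A C b h := by
    clear hb
    induction hab with
    | refl => exact ⟨_, .start ha⟩
    | @tail x y _ hxy ih =>
      obtain ⟨⟨⟨hx, hxC⟩, hy⟩, hm⟩ := hxy
      obtain ⟨h, hr⟩ := ih
      rcases hm with hm | ⟨w, hw, hyw⟩
      · exact ⟨_, hr.step_of_notMem hH hT hs hx hxC hm⟩
      · have : ∃ h : Prop, h ∧ H.ReachedFrom A C w h := by
          clear hyw
          induction hw with
          | single hxw _ => exact ⟨_, hxw, hr.step_of_notMem hH hT hs hx hxC hxw.adj⟩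
          | snoc hw ha _ ih =>
            obtain ⟨h', hh', hr'⟩ := ih
            exact ⟨_, Or.inr ha, hr'.step_of_head hH hT hs hw.mem hh' (Or.inr (H.arc_symm ha))⟩
        obtain ⟨h', hh', hr'⟩ := this
        exact ⟨_, hr'.step_of_head hH hT hs hw.mem hh' hyw⟩
  obtain ⟨h, hr⟩ := key
  exact hr.not_mSep hH hb hs

/-- A connecting path lies in a set all of whose nodes have exits, and is a moral walk there. -/
theorem IsMConnecting.exists_moralReachable (hH : H.IsRegressionChainGraph) {a b : V}
    (ha : a ∈ A) (hb : b ∈ B) (haC : a ∉ C) (hbC : b ∉ C) {p : H.skeleton.Walk a b}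
    (hp : H.IsMConnecting C p) :
    ∃ T, A ∪ B ∪ C ⊆ T ∧ H.HasExits T (A ∪ B ∪ C) ∧ H.MoralReachable T C a b := by
  obtain ⟨hpath, hconn⟩ := hp
  have hne : ∀ n, n + 2 ≤ p.length → p.getVert n ≠ p.getVert (n + 2) := fun n hn h => by
    have := hpath.getVert_injOn (by rw [Set.mem_ofPred]; omega) (by rw [Set.mem_ofPred]; omega) h
    omega
  -- An inner collider of the path has its exit towards `C`. An inner non-collider has an edge of
  -- the path as its exit, either an arrow to a neighbour or a line.
  let T : Set V := {u | u ∈ A ∪ B ∪ C ∨ u ∈ H.ancestors C ∨ ∃ n ≤ p.length, p.getVert n = u}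
  have hpT : ∀ n ≤ p.length, p.getVert n ∈ T := fun n hn => Or.inr (Or.inr ⟨n, hn, rfl⟩)
  have hanT : ∀ u ∈ H.ancestors C, ∃ w ∈ T, H.arrow u w := by
    rintro u ⟨c, hc, huc⟩
    obtain ⟨w, huw, hwc⟩ := TransGen.head'_iff.1 huc
    refine ⟨w, ?_, huw⟩
    rcases reflTransGen_iff_eq_or_transGen.1 hwc with rfl | hwc
    · exact Or.inl (Or.inr hc)
    · exact Or.inr (Or.inl ⟨c, hc, hwc⟩)
  refine ⟨T, fun u hu => Or.inl hu, ?_, ?_⟩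
  · rintro u (hu | hu | ⟨n, hn, rfl⟩) huU
    · exact (huU hu).elim
    · exact Or.inl (hanT u hu)
    · have hn0 : n ≠ 0 := by
        rintro rfl
        exact huU (Or.inl (Or.inl (by simpa using ha)))
      have hnN : n ≠ p.length := by
        rintro rfl
        exact huU (Or.inl (Or.inr (by simpa using hb)))
      obtain ⟨n, rfl⟩ := Nat.exists_eq_succ_of_ne_zero hn0
      by_cases hc : H.IsCollider (p.getVert n) (p.getVert (n + 1)) (p.getVert (n + 2))
      · rcases (hconn n (by omega)).1 hc with h | h
        · exact (huU (Or.inr h)).elim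
        · exact Or.inl (hanT _ h)
      · have h1 := p.adj_getVert_succ (i := n) (by omega)
        have h2 := (p.adj_getVert_succ (i := n + 1) (by omega)).symm
        rcases adj_cases h1 with h1 | h1 | h1
        · rcases adj_cases h2 with h2 | h2 | h2
          · exact (hc ⟨hne n (by omega), h1, h2⟩).elim
          · exact Or.inl ⟨_, hpT _ (by omega), h2⟩
          · exact Or.inr ⟨_, H.line_symm h2⟩
        · exact Or.inl ⟨_, hpT _ (by omega), h1⟩
        · exact Or.inr ⟨_, H.line_symm h1⟩
  -- Nodes of the path in `C` are colliders. Within a run of them, the moral walk waits at the last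
  -- node `z` outside `C` while a collision walk from `z` grows along the path.
  · have key : ∀ n ≤ p.length,
        (p.getVert n ∉ C → H.MoralReachable T C a (p.getVert n)) ∧
        ∀ m, m + 1 = n → H.HeadAt (p.getVert m) (p.getVert n) →
          ∃ z ∈ T \ C, H.MoralReachable T C a z ∧ H.HalfCollision T z (p.getVert n) := by
      intro n
      induction n with
      | zero => exact fun _ => ⟨fun _ => by rw [p.getVert_zero]; exact .refl, by simp⟩
      | succ n ih =>
        intro hn
        have ih := ih (by omega)
        have hadj := p.adj_getVert_succ (i := n) (by omega)
        by_cases hc : p.getVert n ∈ C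
        · have hn0 : n ≠ 0 := by
            rintro rfl
            exact haC (by simpa using hc)
          obtain ⟨m, rfl⟩ := Nat.exists_eq_succ_of_ne_zero hn0
          have hcol : H.IsCollider (p.getVert m) (p.getVert (m + 1)) (p.getVert (m + 2)) := by
            by_contra h
            exact (hconn m hn).2 h hc
          obtain ⟨z, hz, haz, hhalf⟩ := ih.2 m rfl hcol.2.1
          refine ⟨fun hC => haz.tail ⟨⟨hz, hpT _ hn, hC⟩, Or.inr ⟨_, hhalf, hcol.2.2⟩⟩, ?_⟩
          intro k hk hhead
          obtain rfl : k = m + 1 := by omega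
          exact ⟨z, hz, haz, hhalf.snoc (hH.arc_of_headAt hhead hcol.2.2) (hpT _ hn)⟩
        · have hmem : p.getVert n ∈ T \ C := ⟨hpT _ (by omega), hc⟩
          refine ⟨fun hC => (ih.1 hc).tail ⟨⟨hmem, hpT _ hn, hC⟩, Or.inl hadj⟩, ?_⟩
          intro k hk hhead
          obtain rfl : k = n := by omega
          exact ⟨_, hmem, ih.1 hc, .single hhead (hpT _ hn)⟩
    simpa using (key p.length le_rfl).1 (by simpa using hbC)

theorem MoralReachable.of_sameUnshielded (h : SameUnshielded H₁ H₂)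
    (h₁ : H₁.IsRegressionChainGraph) (h₂ : H₂.IsRegressionChainGraph) {a b : V}
    (hab : H₁.MoralReachable T C a b) : H₂.MoralReachable T C a b := by
  induction hab with
  | refl => exact .refl
  | @tail x y _ hxy ih =>
    by_cases heq : x = y
    · exact heq ▸ ih
    · exact ih.tail ⟨hxy.1, h.moralAdj h₁ h₂ heq hxy.2⟩

theorem SameUnshielded.mSep [Finite V] (h : SameUnshielded H₁ H₂)
    (h₁ : H₁.IsRegressionChainGraph) (h₂ : H₂.IsRegressionChainGraph) (hAC : Disjoint A C)
    (hBC : Disjoint B C) (hs : H₂.MSep A B C) : H₁.MSep A B C := by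
  intro a ha b hb p hp
  obtain ⟨T, hUT, hT, hab⟩ := hp.exists_moralReachable h₁ ha hb
    (Set.disjoint_left.1 hAC ha) (Set.disjoint_left.1 hBC hb)
  obtain ⟨S, -, hS, hab'⟩ := h.exists_hasExits h₁ h₂ (Or.inl (Or.inl ha)) (Or.inl (Or.inr hb)) _
    T rfl hUT hT (hab.of_sameUnshielded h h₁ h₂)
  exact hab'.not_mSep h₂ hS ha hb hs

end Connection

/-! ### Separating nonadjacent nodes, and reading the graph off the separations. -/

section Maximality

variable {V : Type*} {H H₁ H₂ : MixedGraph V} {C : Set V}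

/-- An arrowhead at a node excludes lines there, and each arrow followed puts an arrowhead at the
next node. -/
theorem reflTransGen_arrow_of_headAt (hH : H.IsRegressionChainGraph) {x c d : V}
    (hx : H.HeadAt x c) (h : ReflTransGen (fun u w => H.arrow u w ∨ H.line u w) c d) :
    ReflTransGen H.arrow c d := by
  induction h using ReflTransGen.head_induction_on generalizing x with
  | refl => exact .refl
  | head h _ ih =>
    rcases h with h | h
    · exact .head h (ih (Or.inl h))
    · exact (hH.not_line_of_headAt hx h).elim

/-- The nodes of a path are anterior to its endpoints or to a set containing all its colliders. -/
theorem anterior_of_path {D : Set V} (hH : H.IsRegressionChainGraph)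
    (hD : ∀ u w, H.arrow u w ∨ H.line u w → w ∈ D → u ∈ D) {f : ℕ → V} {N : ℕ}
    (hadj : ∀ n < N, H.skeleton.Adj (f n) (f (n + 1))) (h0 : f 0 ∈ D) (hN : f N ∈ D)
    (hcol : ∀ n, n + 2 ≤ N → H.HeadAt (f n) (f (n + 1)) → H.HeadAt (f (n + 2)) (f (n + 1)) →
      f (n + 1) ∈ D) : ∀ n ≤ N, f n ∈ D := by
  have tail : ∀ {u w}, H.skeleton.Adj u w → ¬ H.HeadAt w u → w ∈ D → u ∈ D := by
    intro u w huw hh hw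
    rcases adj_cases huw.symm with h | h | h
    · exact (hh h).elim
    · exact hD _ _ (Or.inl h) hw
    · exact hD _ _ (Or.inr (H.line_symm h)) hw
  have noHead : ∀ {u t w}, H.skeleton.Adj u t → ¬ H.HeadAt t u → ¬ H.HeadAt u t →
      ¬ H.HeadAt w t := by
    intro u t w hut h h' hw
    rcases adj_cases hut with h'' | h'' | h''
    · exact h' h''
    · exact h (Or.inl h'')
    · exact hH.not_line_of_headAt hw (H.line_symm h'')
  -- A node left through an edge without an arrowhead at it is anterior to the next node. Continuing
  -- in that direction leads to a collider or to the end of the path; `left` is the mirror image.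
  have right : ∀ d n, n + d + 1 = N → ¬ H.HeadAt (f (n + 1)) (f n) → f n ∈ D := by
    intro d
    induction d with
    | zero => rintro n rfl hh; exact tail (hadj n (by omega)) hh hN
    | succ d ih =>
      intro n hn hh
      refine tail (hadj n (by omega)) hh ?_
      by_cases hr : H.HeadAt (f (n + 2)) (f (n + 1))
      · by_cases hl : H.HeadAt (f n) (f (n + 1))
        · exact hcol n (by omega) hl hr
        · exact (noHead (hadj n (by omega)) hh hl hr).elim
      · exact ih (n + 1) (by omega) hr
  have left : ∀ n, n + 1 ≤ N → ¬ H.HeadAt (f n) (f (n + 1)) → f (n + 1) ∈ D := by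
    intro n
    induction n with
    | zero => exact fun hn hh => tail (hadj 0 (by omega)).symm hh h0
    | succ n ih =>
      intro hn hh
      refine tail (hadj (n + 1) (by omega)).symm hh ?_
      by_cases hl : H.HeadAt (f n) (f (n + 1))
      · by_cases hr : H.HeadAt (f (n + 2)) (f (n + 1))
        · exact hcol n (by omega) hl hr
        · exact (noHead (hadj (n + 1) (by omega)).symm hh hr hl).elim
      · exact ih (by omega) hl
  intro n hn
  cases n with
  | zero => exact h0
  | succ n =>
    by_cases hl : H.HeadAt (f n) (f (n + 1))
    · rcases hn.eq_or_lt with hnN | hlt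
      · rwa [hnN]
      · by_cases hr : H.HeadAt (f (n + 2)) (f (n + 1))
        · exact hcol n hlt hl hr
        · exact right (N - n - 2) (n + 1) (by omega) hr
    · exact left n hn hl

/-- Regression chain graphs are maximal: nonadjacent nodes are separated by some set. -/
theorem IsRegressionChainGraph.exists_mSep (hH : H.IsRegressionChainGraph) {a b : V}
    (hab : a ≠ b) (hna : ¬ H.skeleton.Adj a b) :
    ∃ C : Set V, a ∉ C ∧ b ∉ C ∧ H.MSep {a} {b} C := by
  let R : V → V → Prop := ReflTransGen fun u w => H.arrow u w ∨ H.line u w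
  -- This is the anterior set of `{a, b}`. A connecting path given `D \ {a, b}` stays inside `D`, so
  -- none of its inner nodes can be a non-collider.
  let D : Set V := {u | R u a ∨ R u b}
  have hD : ∀ u w, H.arrow u w ∨ H.line u w → w ∈ D → u ∈ D := fun u w h hw =>
    hw.imp (.head h) (.head h)
  have hD' : ∀ u w, TransGen H.arrow u w → w ∈ D → u ∈ D := by
    intro u w h hw
    induction h using TransGen.head_induction_on with
    | single h => exact hD _ _ (Or.inl h) hw
    | head h _ ih => exact hD _ _ (Or.inl h) ih
  suffices hsep : ∀ p : H.skeleton.Walk a b, ¬ H.IsMConnecting (D \ {a, b}) p from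
    ⟨D \ {a, b}, by simp, by simp, by rintro _ rfl _ rfl; exact hsep⟩
  rintro p ⟨hpath, hconn⟩
  have hinj : ∀ {m n}, m ≤ p.length → n ≤ p.length → p.getVert m = p.getVert n → m = n :=
    fun hm hn h => hpath.getVert_injOn (by rwa [Set.mem_ofPred]) (by rwa [Set.mem_ofPred]) h
  have hadj : ∀ n < p.length, H.skeleton.Adj (p.getVert n) (p.getVert (n + 1)) :=
    fun n hn => p.adj_getVert_succ hn
  have hpD : ∀ n ≤ p.length, p.getVert n ∈ D := by
    refine anterior_of_path hH hD hadj ?_ ?_ fun n hn hl hr => ?_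
    · rw [p.getVert_zero]; exact Or.inl .refl
    · rw [p.getVert_length]; exact Or.inr .refl
    · have hne : p.getVert n ≠ p.getVert (n + 2) := fun h => by
        have := hinj (by omega) hn h
        omega
      rcases (hconn n hn).1 ⟨hne, hl, hr⟩ with h | ⟨c, hc, h⟩
      · exact h.1
      · exact hD' _ _ h hc.1
  have hcol : ∀ n, n + 2 ≤ p.length →
      H.IsCollider (p.getVert n) (p.getVert (n + 1)) (p.getVert (n + 2)) := by
    intro n hn
    by_contra h
    refine (hconn n hn).2 h ⟨hpD _ (by omega), ?_⟩
    rintro (h | h)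
    · have := hinj (m := n + 1) (n := 0) (by omega) (by omega) (by rw [h, p.getVert_zero])
      omega
    · have := hinj (m := n + 1) (n := p.length) (by omega) le_rfl (by rw [h, p.getVert_length])
      omega
  have hlen : 2 ≤ p.length := by
    by_contra hlt
    have h0 : p.length ≠ 0 := fun h => hab (SimpleGraph.Walk.eq_of_length_eq_zero h)
    exact hna (SimpleGraph.Walk.adj_of_length_eq_one (p := p) (by omega))
  have hseq : H.IsCollisionSeq Set.univ p.getVert (p.length - 1) :=
    ⟨fun n hn => hadj n (by omega), fun n hn => (hcol n (by omega)).2, fun _ _ => trivial⟩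
  have ha1 : H.HeadAt a (p.getVert 1) := by simpa using (hcol 0 hlen).2.1
  -- The first inner node carries an arrowhead, so being anterior to `a` or `b` it is a proper
  -- ancestor of one of them. The path leads back from `a` by one edge, or from `b` by one edge
  -- followed by arcs, and closes a forbidden cycle.
  have hcyc : ∀ z, TransGen H.arrow (p.getVert 1) z → ReflTransGen H.HeadAt z (p.getVert 1) →
      False := by
    intro z h hz
    obtain ⟨w, h1w, hwz⟩ := TransGen.head'_iff.1 h
    exact hH.no_cycle h1w ((ReflTransGen.mono (fun _ _ h => Or.inl h) _ _ hwz).trans hz)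
  have htrans : ∀ z, z ≠ p.getVert 1 → R (p.getVert 1) z → TransGen H.arrow (p.getVert 1) z :=
    fun z hz h => (reflTransGen_iff_eq_or_transGen.1
      (reflTransGen_arrow_of_headAt hH ha1 h)).resolve_left hz
  rcases hpD 1 (by omega) with h | h
  · exact hcyc a (htrans a ha1.ne h) (.single ha1)
  · have hne : b ≠ p.getVert 1 := fun hb => by
      have := hinj (m := 1) (n := p.length) (by omega) le_rfl (hb.symm.trans p.getVert_length.symm)
      omega
    have hb : H.HeadAt b (p.getVert (p.length - 2 + 1)) := by
      have := (hcol (p.length - 2) (by omega)).2.2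
      rwa [Nat.sub_add_cancel hlen, p.getVert_length] at this
    exact hcyc b (htrans b hne h) (.head hb
      (hseq.reflTransGen hH (m := 0) (n := p.length - 2) (by omega) (by omega)))

theorem not_mSep_of_adj {a b : V} (h : H.skeleton.Adj a b) : ¬ H.MSep {a} {b} C := fun hs =>
  hs a rfl b rfl h.toWalk ⟨by simp [h.ne], fun n hn => by simp at hn⟩

theorem not_mSep_of_triple {i t j : V} (hit : H.skeleton.Adj i t) (htj : H.skeleton.Adj t j)
    (hij : i ≠ j) (h : H.IsCollider i t j ∧ t ∈ C ∪ H.ancestors C ∨ ¬ H.IsCollider i t j ∧ t ∉ C) :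
    ¬ H.MSep {i} {j} C := by
  refine fun hs => hs i rfl j rfl (.cons hit htj.toWalk)
    ⟨by simp [hit.ne, htj.ne, hij], fun n hn => ?_⟩
  obtain rfl : n = 0 := by simpa using hn
  simp only [SimpleGraph.Walk.getVert_cons_succ, SimpleGraph.Walk.getVert_zero, zero_add]
  rcases h with ⟨hc, ht⟩ | ⟨hc, ht⟩
  · exact ⟨fun _ => ht, fun h => (h hc).elim⟩
  · exact ⟨fun h => (hc h).elim, fun _ => ht⟩

theorem MarkovEquivalent.symm (h : H₁.MarkovEquivalent H₂) : H₂.MarkovEquivalent H₁ :=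
  fun A B C hAB hAC hBC => (h A B C hAB hAC hBC).symm

theorem MarkovEquivalent.exists_mSep (h : H₁.MarkovEquivalent H₂)
    (h₂ : H₂.IsRegressionChainGraph) {a b : V} (hab : a ≠ b) (hna : ¬ H₂.skeleton.Adj a b) :
    ∃ C, H₁.MSep {a} {b} C ∧ H₂.MSep {a} {b} C := by
  obtain ⟨C, ha, hb, hs⟩ := h₂.exists_mSep hab hna
  exact ⟨C, (h {a} {b} C (by simpa using hab) (by simpa using ha) (by simpa using hb)).2 hs, hs⟩

theorem MarkovEquivalent.adj (h : H₁.MarkovEquivalent H₂) (h₂ : H₂.IsRegressionChainGraph)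
    {a b : V} (hab : H₁.skeleton.Adj a b) : H₂.skeleton.Adj a b := by
  by_contra hna
  obtain ⟨C, hs, -⟩ := h.exists_mSep h₂ hab.ne hna
  exact not_mSep_of_adj hab hs

theorem MarkovEquivalent.skeleton_eq (h : H₁.MarkovEquivalent H₂)
    (h₁ : H₁.IsRegressionChainGraph) (h₂ : H₂.IsRegressionChainGraph) :
    H₁.skeleton = H₂.skeleton := by
  ext a b
  exact ⟨h.adj h₂, h.symm.adj h₁⟩

/-- A set separating `i` from `j` in both graphs must omit `t` where `t` is a collider and contain
`t` where it is not, so the two graphs cannot disagree at `t`. -/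
theorem MarkovEquivalent.isUnshieldedCollider (h : H₁.MarkovEquivalent H₂)
    (h₁ : H₁.IsRegressionChainGraph) (h₂ : H₂.IsRegressionChainGraph) {i t j : V}
    (hc : H₁.IsUnshieldedCollider i t j) : H₂.IsUnshieldedCollider i t j := by
  obtain ⟨⟨hij, hi, hj⟩, hna⟩ := hc
  have hsk := h.skeleton_eq h₁ h₂
  have hna₂ : ¬ H₂.skeleton.Adj i j := hsk ▸ hna
  refine ⟨?_, hna₂⟩
  by_contra hn
  obtain ⟨C, hs₁, hs₂⟩ := h.exists_mSep h₂ hij hna₂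
  by_cases ht : t ∈ C
  · exact not_mSep_of_triple hi.adj hj.adj.symm hij (.inl ⟨⟨hij, hi, hj⟩, .inl ht⟩) hs₁
  · exact not_mSep_of_triple (hsk ▸ hi.adj) (hsk ▸ hj.adj.symm) hij (.inr ⟨hn, ht⟩) hs₂

end Maximality
end MixedGraph

theorem mainTheorem7 {V : Type*} [Finite V] :
    (∀ H₁ H₂ : MixedGraph V, H₁.IsRegressionChainGraph → H₂.IsRegressionChainGraph →
      (H₁.MarkovEquivalent H₂ ↔
        H₁.skeleton = H₂.skeleton ∧
        ∀ i t j, H₁.IsUnshieldedCollider i t j ↔ H₂.IsUnshieldedCollider i t j)) ∧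
    (∀ H : MixedGraph V, H.IsRegressionChainGraph →
      ∀ h l i, H.IsColliderWithOrder h l i → H.IsUnshieldedCollider h l i) := by
  refine ⟨fun H₁ H₂ h₁ h₂ => ⟨fun h => ⟨h.skeleton_eq h₁ h₂, fun i t j =>
    ⟨h.isUnshieldedCollider h₁ h₂, h.symm.isUnshieldedCollider h₂ h₁⟩⟩, ?_⟩,
    fun H hH h l i ⟨hc, n, hn⟩ => hH.isUnshieldedCollider_of_order hc hn⟩
  rintro ⟨hs, hu⟩ A B C - hAC hBC
  have h : MixedGraph.SameUnshielded H₁ H₂ := ⟨hs, hu⟩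
  exact ⟨h.symm.mSep h₂ h₁ hAC hBC, h.mSep h₁ h₂ hAC hBC⟩
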